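/- Let $K\ge 0$ and $d_1,\dots,d_K$ be integers, let a slate be a vector $a=(a_1,\dots,a_K)$ with $a_k\in\{1,\dots,d_k\}$, and let $(X_i,A_i,R_i)$, $i=1,2,\dots$, be independent copies of a triplet $(X,A,R)$ of a context, a slate and a real reward, where $X\sim P_X$, $A\sim\mu(\cdot\mid X)$ and $R\sim\mathbb P(\cdot\mid A,X)$. Assume that the logging policy is factored, $\mu(a\mid x)=\prod_{k=1}^K\mu_k(a_k\mid x)$. Let $\pi(\cdot\mid x)$ be a fixed target policy on slates (not necessarily factored), let $\pi(a_k\mid x)$ denote the probability it gives to action $a_k$ in slot $k$, and assume that $\pi(a_k\mid x)=0$ whenever $\mu_k(a_k\mid x)=0$, for $P_X$-almost every $x$. Put $$Y_k=\frac{\pi(A_k\mid X)}{\mu_k(A_k\mid X)},\qquad G=1+\sum_{k=1}^K(Y_k-1),\qquad \theta=\mathbb E[GR],$$ and assume $\mathbb E[(GR)^2]<\infty$ and $\mathbb E[Y_k^2]<\infty$ for every $k$. For $w\in\mathbb R^K$ let $$\Gamma_w=GR-\sum_{k=1}^K w_k(Y_k-1),\qquad \hat\theta_n^{(w)}=\mathbb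 E_n[\Gamma_w],\qquad V_w=\operatorname{Var}(\Gamma_w),\qquad V^*=\inf_{w\in\mathbb R^K}V_w,$$ where $\mathbb E_n[f(X,A,R)]=\frac1n\sum_{i=1}^n f(X_i,A_i,R_i)$. Define the data-driven weights $\hat w^*_n=(\hat w^*_{n,1},\dots,\hat w^*_{n,K})$ by $$\hat w^*_{n,k}=\frac{\mathbb E_n[GR(Y_k-1)]}{\mathbb E_n[(Y_k-1)^2]},$$ with $0/0=0$ (if the denominator vanishes then so does the numerator, and $\hat\theta_n^{(w)}$ does not depend on $w_k$). Then, as $n\to\infty$, $$\sqrt n\,\bigl(\hat\theta_n^{(\hat w^*_n)}-\theta\bigr)\to_d\mathcal N(0,V^*),$$ where $\mathcal N(0,0)$ is the point mass at $0$. That is, the feasible estimator with data-driven weights attains the smallest asymptotic variance in the class $\{\hat\theta_n^{(w)}:w\in\mathbb R^K\}$. -/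

import Mathlib

open MeasureTheory ProbabilityTheory Filter
open scoped NNReal

noncomputable section

namespace SlateOPE

/-- The slates with `K` slots and `d k` available actions in slot `k`. -/
abbrev Slate {K : ℕ} (d : Fin K → ℕ) : Type := (k : Fin K) → Fin (d k)

/-- The triplets (context, slate, reward), arranged as `((x, a), r)`. -/
abbrev Triplet (𝒳 : Type*) {K : ℕ} (d : Fin K → ℕ) : Type _ := (𝒳 × Slate d) × ℝ

variable {𝒳 : Type*} [MeasurableSpace 𝒳] {K : ℕ} {d : Fin K → ℕ}

/-- The law of a generic triplet: `X ∼ PX`, `A ∼ μ(· ∣ X)`, `R ∼ ρ(· ∣ X, A)`. -/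
def law (PX : Measure 𝒳) (μ : Kernel 𝒳 (Slate d)) (ρ : Kernel (𝒳 × Slate d) ℝ) :
    Measure (Triplet 𝒳 d) :=
  (PX ⊗ₘ μ) ⊗ₘ ρ

/-- The slot-level marginal `π(a_k ∣ x)` of a policy `π` on slates: the probability that slot `k`
receives action `j`. -/
def slotMarginal (π : Kernel 𝒳 (Slate d)) (k : Fin K) (x : 𝒳) (j : Fin (d k)) : ℝ :=
  (π x).real {a | a k = j}

/-- The policy `μ` is factored with slot policies `μs k`, for `PX`-almost every context. -/
def IsFactored (PX : Measure 𝒳) (μ : Kernel 𝒳 (Slate d))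
    (μs : (k : Fin K) → Kernel 𝒳 (Fin (d k))) : Prop :=
  ∀ᵐ x ∂PX, ∀ a : Slate d, (μ x).real {a} = ∏ k, (μs k x).real {a k}

/-- Slot-level coverage: for `PX`-almost every context, an action that the slot policy `μs k` never
takes is not taken in slot `k` by the target policy `π` either. -/
def Covers (PX : Measure 𝒳) (μs : (k : Fin K) → Kernel 𝒳 (Fin (d k)))
    (π : Kernel 𝒳 (Slate d)) : Prop :=
  ∀ᵐ x ∂PX, ∀ k, ∀ j : Fin (d k), (μs k x).real {j} = 0 → slotMarginal π k x j = 0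

/-- The slot-level density ratio `Y_k = π(A_k ∣ X) / μ_k(A_k ∣ X)`. -/
def Y (μs : (k : Fin K) → Kernel 𝒳 (Fin (d k))) (π : Kernel 𝒳 (Slate d)) (k : Fin K)
    (z : Triplet 𝒳 d) : ℝ :=
  slotMarginal π k z.1.1 (z.1.2 k) / (μs k z.1.1).real {z.1.2 k}

/-- `G = 1 + ∑ k, (Y_k - 1)`. -/
def G (μs : (k : Fin K) → Kernel 𝒳 (Fin (d k))) (π : Kernel 𝒳 (Slate d))
    (z : Triplet 𝒳 d) : ℝ :=
  1 + ∑ k, (Y μs π k z - 1)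

/-- The product `G R`. -/
def GR (μs : (k : Fin K) → Kernel 𝒳 (Fin (d k))) (π : Kernel 𝒳 (Slate d))
    (z : Triplet 𝒳 d) : ℝ :=
  G μs π z * z.2

/-- `Γ_w = G R - ∑ k, w_k (Y_k - 1)`. -/
def Gam (μs : (k : Fin K) → Kernel 𝒳 (Fin (d k))) (π : Kernel 𝒳 (Slate d)) (w : Fin K → ℝ)
    (z : Triplet 𝒳 d) : ℝ :=
  GR μs π z - ∑ k, w k * (Y μs π k z - 1)

/-- The estimand `θ = 𝔼[G R]`, for the law `P` of the triplet. -/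
def theta (P : Measure (Triplet 𝒳 d)) (μs : (k : Fin K) → Kernel 𝒳 (Fin (d k)))
    (π : Kernel 𝒳 (Slate d)) : ℝ :=
  ∫ z, GR μs π z ∂P

/-- `V_w = Var(Γ_w)`, for the law `P` of the triplet. -/
def V (P : Measure (Triplet 𝒳 d)) (μs : (k : Fin K) → Kernel 𝒳 (Fin (d k)))
    (π : Kernel 𝒳 (Slate d)) (w : Fin K → ℝ) : ℝ :=
  variance (Gam μs π w) P

/-- `V* = inf_w V_w`, the infimum over all weight vectors `w ∈ ℝ^K`. -/
def Vstar (P : Measure (Triplet 𝒳 d)) (μs : (k : Fin K) → Kernel 𝒳 (Fin (d k)))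
    (π : Kernel 𝒳 (Slate d)) : ℝ :=
  ⨅ w : Fin K → ℝ, V P μs π w

/-- `V*` is a genuine infimum: no truncation happens when it is read as a nonnegative real. -/
theorem Vstar_nonneg (P : Measure (Triplet 𝒳 d)) (μs : (k : Fin K) → Kernel 𝒳 (Fin (d k)))
    (π : Kernel 𝒳 (Slate d)) : 0 ≤ Vstar P μs π :=
  Real.iInf_nonneg fun _ => variance_nonneg _ _

/-- The empirical mean `𝔼_n[f] = (1 / n) ∑_{i < n} f(z_i)` over the first `n` observations. -/
def empMean (z : ℕ → Triplet 𝒳 d) (n : ℕ) (f : Triplet 𝒳 d → ℝ) : ℝ :=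
  (1 / (n : ℝ)) * ∑ i ∈ Finset.range n, f (z i)

/-- The estimator `θ̂_n^{(w)} = 𝔼_n[Γ_w]`. -/
def thetaHat (μs : (k : Fin K) → Kernel 𝒳 (Fin (d k))) (π : Kernel 𝒳 (Slate d))
    (z : ℕ → Triplet 𝒳 d) (n : ℕ) (w : Fin K → ℝ) : ℝ :=
  empMean z n (Gam μs π w)

/-- The data-driven weights `ŵ*_{n,k} = 𝔼_n[G R (Y_k - 1)] / 𝔼_n[(Y_k - 1)²]`. If the denominator
vanishes then `Y_k = 1` at all `n` observations, so that `𝔼_n[Γ_w]` does not depend on `w_k`. -/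
def wHat (μs : (k : Fin K) → Kernel 𝒳 (Fin (d k))) (π : Kernel 𝒳 (Slate d))
    (z : ℕ → Triplet 𝒳 d) (n : ℕ) (k : Fin K) : ℝ :=
  empMean z n (fun t => GR μs π t * (Y μs π k t - 1)) /
    empMean z n (fun t => (Y μs π k t - 1) ^ 2)

end SlateOPE

end

/-! Given the context, a factored logging policy makes the slots independent, and coverage gives
each ratio `Y_k` conditional mean one. Hence the control variates `Y_k - 1` are centred and pairwise
orthogonal (`integral_prod_Y_sub_one`). Minimizing the variance therefore decouples into
one-dimensional regressions, with optimum w*_k = 𝔼[GR(Y_k - 1)] / 𝔼[(Y_k - 1)²]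
(`iInf_variance_sub_sum_mul`), and `wHat` is its empirical version.

The estimator with weights ŵ differs from the one with weights w* by ∑ k, 𝔼_n[Y_k - 1] (w*_k - ŵ_k).
After scaling by √n, the first factor converges in distribution by the CLT and the second tends to 0
by the law of large numbers. By Slutsky the difference is negligible, and the CLT at w* gives the
limit. -/

open MeasureTheory ProbabilityTheory Filter
open scoped Topology

/-! ### Slutsky-type lemmas. -/

section ConvergenceInDistribution

variable {Ω Ω' : Type*} [MeasurableSpace Ω] [MeasurableSpace Ω'] {Q : Measure Ω}
  [IsProbabilityMeasure Q] {Q' : Measure Ω'} [IsProbabilityMeasure Q'] {ι : Type*} {l : Filter ι}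

/-- Convergence in distribution to a constant implies convergence in probability. -/
theorem tendstoInMeasure_of_tendstoInDistribution_const {U : ι → Ω → ℝ} {c : ℝ}
    (h : TendstoInDistribution U l (fun _ : Ω' => c) (fun _ => Q) Q') :
    TendstoInMeasure Q U l (fun _ => c) := by
  rw [tendstoInMeasure_iff_norm]
  intro ε hε
  have hmeas : MeasurableSet {x : ℝ | ε ≤ ‖x - c‖} :=
    measurableSet_le measurable_const (by fun_prop)
  -- Portmanteau applies: the Dirac mass at `c` does not charge the sphere of radius ε > 0.
  have hfr : frontier {x : ℝ | ε ≤ ‖x - c‖} ⊆ {x : ℝ | ε = ‖x - c‖} :=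
    frontier_le_subset_eq continuous_const (by fun_prop)
  have key := ProbabilityMeasure.tendsto_measure_of_null_frontier_of_tendsto' h.tendsto
    (E := {x : ℝ | ε ≤ ‖x - c‖}) (by
      refine measure_mono_null hfr ?_
      simp [Measure.map_const, hε.ne'])
  simp only [ProbabilityMeasure.coe_mk] at key
  have hz : (Q'.map fun _ : Ω' => c) {x : ℝ | ε ≤ ‖x - c‖} = 0 := by
    rw [Measure.map_const]
    simp [hε]
  rw [hz] at key
  refine key.congr fun i => ?_
  rw [Measure.map_apply_of_aemeasurable (h.forall_aemeasurable i) hmeas]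
  rfl

/-- A sequence that converges in distribution times one that converges to `0` in probability
converges to `0` in probability. -/
theorem TendstoInDistribution.mul_tendstoInMeasure_zero [l.IsCountablyGenerated]
    {U D : ι → Ω → ℝ} {Z : Ω' → ℝ}
    (hU : TendstoInDistribution U l Z (fun _ => Q) Q')
    (hD : TendstoInMeasure Q D l (fun _ => 0)) (hDm : ∀ i, AEMeasurable (D i) Q) :
    TendstoInMeasure Q (fun i ω => U i ω * D i ω) l (fun _ => 0) := by
  have h := hU.continuous_comp_prodMk_of_tendstoInMeasure_const
    (g := fun p : ℝ × ℝ => p.1 * p.2) (by fun_prop) hD hDm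
  simp only [mul_zero] at h
  exact tendstoInMeasure_of_tendstoInDistribution_const h

end ConvergenceInDistribution

/-! ### Law of large numbers and CLT for sample means. -/

section SampleMean

/-- The mean of `f` over the first `n` observations. -/
noncomputable def sampleMean {𝓩 : Type*} (z : ℕ → 𝓩) (n : ℕ) (f : 𝓩 → ℝ) : ℝ :=
  (1 / (n : ℝ)) * ∑ i ∈ Finset.range n, f (z i)

theorem sampleMean_sub {𝓩 : Type*} (z : ℕ → 𝓩) (n : ℕ) (f g : 𝓩 → ℝ) :
    sampleMean z n (fun t => f t - g t) = sampleMean z n f - sampleMean z n g := by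
  simp only [sampleMean, Finset.sum_sub_distrib, mul_sub]

theorem sampleMean_sum_mul {𝓩 ι : Type*} [Fintype ι] (z : ℕ → 𝓩) (n : ℕ) (w : ι → ℝ)
    (y : ι → 𝓩 → ℝ) :
    sampleMean z n (fun t => ∑ k, w k * y k t) = ∑ k, w k * sampleMean z n (y k) := by
  simp only [sampleMean]
  rw [Finset.sum_comm, Finset.mul_sum]
  refine Finset.sum_congr rfl fun k _ => ?_
  rw [← Finset.mul_sum]
  ring

variable {𝓩 Ω : Type*} [MeasurableSpace 𝓩] [MeasurableSpace Ω] {P : Measure 𝓩}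
  {Q : Measure Ω} {z : ℕ → Ω → 𝓩}

theorem HasLaw.aemeasurable_comp {z : Ω → 𝓩} (hz : HasLaw z P Q) {f : 𝓩 → ℝ}
    (hf : AEMeasurable f P) : AEMeasurable (fun ω => f (z ω)) Q :=
  (hz.map_eq.symm ▸ hf : AEMeasurable f (Q.map z)).comp_aemeasurable hz.aemeasurable

theorem aemeasurable_sampleMean (hz : ∀ i, HasLaw (z i) P Q) {f : 𝓩 → ℝ} (hf : AEMeasurable f P)
    (n : ℕ) : AEMeasurable (fun ω => sampleMean (fun i => z i ω) n f) Q :=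
  (Finset.aemeasurable_fun_sum _ fun i _ => HasLaw.aemeasurable_comp (hz i) hf).const_mul _

theorem identDistrib_comp_of_hasLaw (hz : ∀ i, HasLaw (z i) P Q) {f : 𝓩 → ℝ}
    (hf : AEMeasurable f P) (i j : ℕ) :
    IdentDistrib (fun ω => f (z i ω)) (fun ω => f (z j ω)) Q Q :=
  ((hz i).identDistrib (hz j)).comp_of_aemeasurable ((hz i).map_eq.symm ▸ hf)

theorem iIndepFun_comp_of_hasLaw (hz : ∀ i, HasLaw (z i) P Q) (hind : iIndepFun z Q) {f : 𝓩 → ℝ}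
    (hf : AEMeasurable f P) : iIndepFun (fun i ω => f (z i ω)) Q :=
  hind.comp₀ (fun _ => f) (fun i => (hz i).aemeasurable) fun i => (hz i).map_eq.symm ▸ hf

theorem HasLaw.integral_comp_real {z : Ω → 𝓩} (hz : HasLaw z P Q) {f : 𝓩 → ℝ}
    (hf : AEMeasurable f P) : ∫ ω, f (z ω) ∂Q = ∫ t, f t ∂P :=
  hz.integral_comp hf.aestronglyMeasurable

/-- The strong law of large numbers for the sample means of an integrable function. -/
theorem ae_tendsto_sampleMean (hz : ∀ i, HasLaw (z i) P Q) (hind : iIndepFun z Q) {f : 𝓩 → ℝ}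
    (hf : Integrable f P) :
    ∀ᵐ ω ∂Q, Tendsto (fun n => sampleMean (fun i => z i ω) n f) atTop (𝓝 (∫ t, f t ∂P)) := by
  have hfm := hf.aemeasurable
  have hint : Integrable (fun ω => f (z 0 ω)) Q :=
    (show Integrable f (Q.map (z 0)) from (hz 0).map_eq.symm ▸ hf).comp_aemeasurable
      (hz 0).aemeasurable
  have h := strong_law_ae_real (fun i ω => f (z i ω)) hint
    (fun i j hij => (iIndepFun_comp_of_hasLaw hz hind hfm).indepFun hij)
    (fun i => identDistrib_comp_of_hasLaw hz hfm i 0)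
  filter_upwards [h] with ω hω
  rw [HasLaw.integral_comp_real (hz 0) hfm] at hω
  refine hω.congr fun n => ?_
  simp only [sampleMean]
  ring

variable [IsProbabilityMeasure Q]

/-- The central limit theorem for the sample means of a square-integrable function. -/
theorem tendstoInDistribution_sqrt_mul_sampleMean_sub (hz : ∀ i, HasLaw (z i) P Q)
    (hind : iIndepFun z Q) {f : 𝓩 → ℝ} (hf : MemLp f 2 P) :
    TendstoInDistribution
      (fun (n : ℕ) ω => √(n : ℝ) * (sampleMean (fun i => z i ω) n f - ∫ t, f t ∂P))
      atTop id (fun _ => Q) (gaussianReal 0 (variance f P).toNNReal) := by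
  have hfm := hf.aemeasurable
  have hint : MemLp (fun ω => f (z 0 ω)) 2 Q :=
    (show MemLp f 2 (Q.map (z 0)) from (hz 0).map_eq.symm ▸ hf).comp_of_map (hz 0).aemeasurable
  have hvar : variance (fun ω => f (z 0 ω)) Q = variance f P := by
    rw [← (hz 0).map_eq, variance_map ((hz 0).map_eq.symm ▸ hfm) (hz 0).aemeasurable]
    rfl
  have h := tendstoInDistribution_inv_sqrt_mul_sum_sub (P := Q)
    (P' := gaussianReal 0 (variance f P).toNNReal) (X := fun i ω => f (z i ω)) (Y := id)
    (by rw [hvar]; exact HasLaw.id) hint (iIndepFun_comp_of_hasLaw hz hind hfm)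
    (fun i => identDistrib_comp_of_hasLaw hz hfm i 0)
  refine h.congr (fun n => ae_of_all _ fun ω => ?_) (ae_eq_refl _)
  simp only [sampleMean]
  rw [HasLaw.integral_comp_real (hz 0) hfm]
  rcases Nat.eq_zero_or_pos n with rfl | hn
  · simp
  have hs : √(n : ℝ) ≠ 0 := by positivity
  have hss : √(n : ℝ) * √(n : ℝ) = n := Real.mul_self_sqrt (by positivity)
  have hn' : (n : ℝ) ≠ 0 := by positivity
  field_simp
  rw [pow_two, hss]

end SampleMean

/-! ### Optimal weights for orthogonal control variates. -/

section ControlVariates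

variable {𝓩 : Type*} [MeasurableSpace 𝓩] {P : Measure 𝓩} {ι : Type*} [Fintype ι]

/-- The regression coefficient `𝔼[g y] / 𝔼[y²]` of `g` on `y`, equal to `0` if `y = 0` a.e. -/
noncomputable def regressionCoeff (P : Measure 𝓩) (g y : 𝓩 → ℝ) : ℝ :=
  (∫ t, g t * y t ∂P) / ∫ t, y t ^ 2 ∂P

theorem ae_eq_zero_of_integral_sq_eq_zero {y : 𝓩 → ℝ} (hy : MemLp y 2 P)
    (h : ∫ t, y t ^ 2 ∂P = 0) : y =ᵐ[P] 0 := by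
  have := (integral_eq_zero_iff_of_nonneg (fun t => sq_nonneg (y t)) hy.integrable_sq).1 h
  filter_upwards [this] with t ht
  simpa using ht

/-- The normal equation. It survives a zero denominator, since then y = 0 a.e. and the right side
vanishes too. -/
theorem regressionCoeff_mul_integral_sq {g y : 𝓩 → ℝ} (hy : MemLp y 2 P) :
    regressionCoeff P g y * ∫ t, y t ^ 2 ∂P = ∫ t, g t * y t ∂P := by
  by_cases h : ∫ t, y t ^ 2 ∂P = 0
  · rw [h, mul_zero, eq_comm]
    refine integral_eq_zero_of_ae ?_
    filter_upwards [ae_eq_zero_of_integral_sq_eq_zero hy h] with t ht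
    simp [ht]
  · exact div_mul_cancel₀ _ h

theorem memLp_sum_mul {y : ι → 𝓩 → ℝ} (hy : ∀ k, MemLp (y k) 2 P) (w : ι → ℝ) :
    MemLp (fun t => ∑ k, w k * y k t) 2 P :=
  memLp_finsetSum _ fun k _ => (hy k).const_mul (w k)

theorem memLp_sub_sum_mul {g : 𝓩 → ℝ} {y : ι → 𝓩 → ℝ} (hg : MemLp g 2 P)
    (hy : ∀ k, MemLp (y k) 2 P) (w : ι → ℝ) : MemLp (fun t => g t - ∑ k, w k * y k t) 2 P :=
  hg.sub (memLp_sum_mul hy w)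

variable [IsProbabilityMeasure P] {g : 𝓩 → ℝ} {y : ι → 𝓩 → ℝ}

theorem integral_sub_sum_mul (hg : MemLp g 2 P) (hy : ∀ k, MemLp (y k) 2 P)
    (hmean : ∀ k, ∫ t, y k t ∂P = 0) (w : ι → ℝ) :
    ∫ t, (g t - ∑ k, w k * y k t) ∂P = ∫ t, g t ∂P := by
  have hi : ∀ k ∈ Finset.univ, Integrable (fun t => w k * y k t) P :=
    fun k _ => ((hy k).integrable (by norm_num)).const_mul _
  rw [integral_sub (hg.integrable (by norm_num)) (integrable_finsetSum _ hi),
    integral_finsetSum _ hi]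
  simp [integral_const_mul, hmean]

/-- The residual of `g` after regression on centred orthogonal control variates is uncorrelated
with each of them. -/
theorem covariance_residual_eq_zero (hg : MemLp g 2 P) (hy : ∀ k, MemLp (y k) 2 P)
    (hmean : ∀ k, ∫ t, y k t ∂P = 0) (horth : ∀ k l, k ≠ l → ∫ t, y k t * y l t ∂P = 0) (l : ι) :
    covariance (fun t => g t - ∑ k, regressionCoeff P g (y k) * y k t) (y l) P = 0 := by
  classical
  have hcov : ∀ f : 𝓩 → ℝ, MemLp f 2 P → covariance f (y l) P = ∫ t, f t * y l t ∂P := by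
    intro f hf
    rw [covariance_eq_sub hf (hy l), hmean l, mul_zero, sub_zero]
    rfl
  rw [covariance_fun_sub_left hg (memLp_sum_mul hy _) (hy l),
    covariance_fun_sum_left (fun k => (hy k).const_mul _) (hy l), hcov g hg]
  simp_rw [covariance_const_mul_left, hcov _ (hy _)]
  rw [Finset.sum_eq_single l (fun k _ hk => by rw [horth k l hk, mul_zero]) (by simp)]
  simp_rw [← pow_two]
  rw [regressionCoeff_mul_integral_sq (hy l), sub_self]

/-- The regression coefficients minimize the variance among all linear combinations of centred
orthogonal control variates. -/
theorem iInf_variance_sub_sum_mul (hg : MemLp g 2 P) (hy : ∀ k, MemLp (y k) 2 P)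
    (hmean : ∀ k, ∫ t, y k t ∂P = 0) (horth : ∀ k l, k ≠ l → ∫ t, y k t * y l t ∂P = 0) :
    ⨅ w : ι → ℝ, variance (fun t => g t - ∑ k, w k * y k t) P =
      variance (fun t => g t - ∑ k, regressionCoeff P g (y k) * y k t) P := by
  refine le_antisymm (ciInf_le ⟨0, ?_⟩ fun k => regressionCoeff P g (y k)) (le_ciInf fun w => ?_)
  · rintro _ ⟨w, rfl⟩
    exact variance_nonneg _ _
  have hres := memLp_sub_sum_mul hg hy fun k => regressionCoeff P g (y k)
  -- Pythagoras: the residual is uncorrelated with every combination of the `y k`, so any other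
  -- weights only add the variance of such a combination.
  have hsplit : (fun t => g t - ∑ k, w k * y k t) =
      fun t => (g t - ∑ k, regressionCoeff P g (y k) * y k t) -
        ∑ k, (w k - regressionCoeff P g (y k)) * y k t := by
    funext t
    simp only [sub_mul, Finset.sum_sub_distrib]
    ring
  have hcov : covariance (fun t => g t - ∑ k, regressionCoeff P g (y k) * y k t)
      (fun t => ∑ k, (w k - regressionCoeff P g (y k)) * y k t) P = 0 := by
    rw [covariance_fun_sum_right (fun k => (hy k).const_mul _) hres]
    refine Finset.sum_eq_zero fun k _ => ?_
    rw [covariance_const_mul_right, covariance_residual_eq_zero hg hy hmean horth, mul_zero]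
  rw [hsplit, variance_fun_sub hres (memLp_sum_mul hy _), hcov, mul_zero, sub_zero]
  exact le_add_of_nonneg_right (variance_nonneg _ _)

end ControlVariates

/-! ### Replacing the optimal weights by empirical ones. -/

section DataDrivenWeights

variable {𝓩 Ω : Type*} [MeasurableSpace 𝓩] [MeasurableSpace Ω] {P : Measure 𝓩}
  {Q : Measure Ω} {z : ℕ → Ω → 𝓩}

/-- The empirical regression coefficient of `g` on `y`, equal to `0` if `y` vanishes at all
observations. -/
noncomputable def sampleRegressionCoeff (z : ℕ → 𝓩) (n : ℕ) (g y : 𝓩 → ℝ) : ℝ :=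
  sampleMean z n (fun t => g t * y t) / sampleMean z n (fun t => y t ^ 2)

theorem aemeasurable_sampleRegressionCoeff (hz : ∀ i, HasLaw (z i) P Q) {g y : 𝓩 → ℝ}
    (hg : AEMeasurable g P) (hy : AEMeasurable y P) (n : ℕ) :
    AEMeasurable (fun ω => sampleRegressionCoeff (fun i => z i ω) n g y) Q :=
  (aemeasurable_sampleMean hz (hg.mul hy) n).div (aemeasurable_sampleMean hz (hy.pow_const 2) n)

/-- The empirical regression coefficient is strongly consistent, also in the degenerate case
`y = 0` a.e. -/
theorem ae_tendsto_sampleRegressionCoeff (hz : ∀ i, HasLaw (z i) P Q) (hind : iIndepFun z Q)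
    {g y : 𝓩 → ℝ} (hg : MemLp g 2 P) (hy : MemLp y 2 P) :
    ∀ᵐ ω ∂Q, Tendsto (fun n => sampleRegressionCoeff (fun i => z i ω) n g y) atTop
      (𝓝 (regressionCoeff P g y)) := by
  by_cases h : ∫ t, y t ^ 2 ∂P = 0
  · have hy0 := ae_eq_zero_of_integral_sq_eq_zero hy h
    have hall : ∀ᵐ ω ∂Q, ∀ i, y (z i ω) = 0 := by
      refine ae_all_iff.2 fun i => ?_
      exact ae_of_ae_map (hz i).aemeasurable ((hz i).map_eq.symm ▸ hy0)
    filter_upwards [hall] with ω hω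
    simp [sampleRegressionCoeff, sampleMean, regressionCoeff, hω, h]
  · filter_upwards [ae_tendsto_sampleMean hz hind (hg.integrable_mul hy),
      ae_tendsto_sampleMean hz hind hy.integrable_sq] with ω h₁ h₂
    exact h₁.div h₂ h

variable [IsProbabilityMeasure P] [IsProbabilityMeasure Q] {ι : Type*} [Fintype ι]

/-- The control-variate estimator with empirical regression weights, for centred orthogonal
control variates, is asymptotically normal with the smallest variance that fixed weights attain. -/
theorem tendstoInDistribution_sampleMean_sub_sampleRegressionCoeff
    (hz : ∀ i, HasLaw (z i) P Q) (hind : iIndepFun z Q) {g : 𝓩 → ℝ} {y : ι → 𝓩 → ℝ}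
    (hg : MemLp g 2 P) (hy : ∀ k, MemLp (y k) 2 P) (hmean : ∀ k, ∫ t, y k t ∂P = 0)
    (horth : ∀ k l, k ≠ l → ∫ t, y k t * y l t ∂P = 0) :
    TendstoInDistribution
      (fun (n : ℕ) ω => √(n : ℝ) *
        (sampleMean (fun i => z i ω) n
          (fun t => g t - ∑ k, sampleRegressionCoeff (fun i => z i ω) n g (y k) * y k t)
          - ∫ t, g t ∂P))
      atTop id (fun _ => Q)
      (gaussianReal 0
        (⨅ w : ι → ℝ, variance (fun t => g t - ∑ k, w k * y k t) P).toNNReal) := by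
  classical
  rw [iInf_variance_sub_sum_mul hg hy hmean horth]
  have hclt := tendstoInDistribution_sqrt_mul_sampleMean_sub hz hind
    (memLp_sub_sum_mul hg hy fun k => regressionCoeff P g (y k))
  -- Since `y k` is centred, √n times its sample mean obeys the CLT; the weight error tends to 0
  -- almost surely.
  have hcorr (k : ι) : TendstoInMeasure Q
      (fun (n : ℕ) ω => √(n : ℝ) * sampleMean (fun i => z i ω) n (y k) *
        (regressionCoeff P g (y k) - sampleRegressionCoeff (fun i => z i ω) n g (y k)))
      atTop (fun _ => 0) := by
    have hU := tendstoInDistribution_sqrt_mul_sampleMean_sub hz hind (hy k)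
    simp only [hmean, sub_zero] at hU
    have hm (n : ℕ) : AEMeasurable (fun ω => regressionCoeff P g (y k) -
        sampleRegressionCoeff (fun i => z i ω) n g (y k)) Q :=
      (aemeasurable_sampleRegressionCoeff hz hg.aemeasurable (hy k).aemeasurable n).const_sub _
    refine TendstoInDistribution.mul_tendstoInMeasure_zero hU
      (tendstoInMeasure_of_tendsto_ae (fun n => (hm n).aestronglyMeasurable) ?_) hm
    filter_upwards [ae_tendsto_sampleRegressionCoeff hz hind hg (hy k)] with ω hω
    simpa using hω.const_sub (regressionCoeff P g (y k))
  have hcorrm (k : ι) (n : ℕ) : AEMeasurable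
      (fun ω => √(n : ℝ) * sampleMean (fun i => z i ω) n (y k) *
        (regressionCoeff P g (y k) - sampleRegressionCoeff (fun i => z i ω) n g (y k))) Q :=
    ((aemeasurable_sampleMean hz (hy k).aemeasurable n).const_mul _).mul
      ((aemeasurable_sampleRegressionCoeff hz hg.aemeasurable (hy k).aemeasurable n).const_sub _)
  -- The corrections are added one slot at a time, each leaving the limit law unchanged by Slutsky.
  have hsum (s : Finset ι) : TendstoInDistribution
      (fun (n : ℕ) ω => √(n : ℝ) * (sampleMean (fun i => z i ω) n
          (fun t => g t - ∑ k, regressionCoeff P g (y k) * y k t) -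
          ∫ t, (g t - ∑ k, regressionCoeff P g (y k) * y k t) ∂P) +
        ∑ k ∈ s, √(n : ℝ) * sampleMean (fun i => z i ω) n (y k) *
          (regressionCoeff P g (y k) - sampleRegressionCoeff (fun i => z i ω) n g (y k)))
      atTop id (fun _ => Q)
      (gaussianReal 0
        (variance (fun t => g t - ∑ k, regressionCoeff P g (y k) * y k t) P).toNNReal) := by
    induction s using Finset.induction_on with
    | empty => simpa using hclt
    | insert k s hk ih =>
      refine (ih.add_of_tendstoInMeasure_const (hcorr k) (hcorrm k)).congr
        (fun n => ae_of_all _ fun ω => ?_) (ae_of_all _ fun x => add_zero x)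
      simp only [Pi.add_apply, Finset.sum_insert hk]
      ring
  refine (hsum Finset.univ).congr (fun n => ae_of_all _ fun ω => ?_) (ae_eq_refl _)
  -- For fixed ω the random weights are constants in `t`, so they can be pulled out of the sample
  -- mean.
  simp only [integral_sub_sum_mul hg hy hmean, sampleMean_sub, sampleMean_sum_mul, mul_sub,
    Finset.sum_sub_distrib, Finset.mul_sum]
  simp only [mul_assoc, mul_comm (sampleMean _ _ _)]
  ring

end DataDrivenWeights

/-! ### Moments of the slot-level density ratios. -/

namespace SlateOPE

variable {𝒳 : Type*} [MeasurableSpace 𝒳] {K : ℕ} {d : Fin K → ℕ} {PX : Measure 𝒳}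
  {μ : Kernel 𝒳 (Slate d)} {μs : (k : Fin K) → Kernel 𝒳 (Fin (d k))}
  {ρ : Kernel (𝒳 × Slate d) ℝ} {π : Kernel 𝒳 (Slate d)}

theorem sum_slotMarginal [IsMarkovKernel π] (k : Fin K) (x : 𝒳) :
    ∑ j, slotMarginal π k x j = 1 := by
  have h := sum_measureReal_preimage_singleton (μ := π x) (Finset.univ : Finset (Fin (d k)))
    (f := fun a : Slate d => a k) fun _ _ => measurable_pi_apply k (measurableSet_singleton _)
  simpa [slotMarginal, Set.preimage] using h

/-- Given the context, the slot-level density ratios have mean one. -/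
theorem sum_mul_ratio_sub_one [∀ k, IsMarkovKernel (μs k)] [IsMarkovKernel π] {x : 𝒳} {k : Fin K}
    (hcov : ∀ j, (μs k x).real {j} = 0 → slotMarginal π k x j = 0) :
    ∑ j, (μs k x).real {j} * (slotMarginal π k x j / (μs k x).real {j} - 1) = 0 := by
  have h : ∀ j, (μs k x).real {j} * (slotMarginal π k x j / (μs k x).real {j} - 1) =
      slotMarginal π k x j - (μs k x).real {j} := by
    intro j
    by_cases hj : (μs k x).real {j} = 0
    · rw [hj, hcov j hj]; simp
    · field_simp
  simp_rw [h, Finset.sum_sub_distrib, sum_slotMarginal]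
  simp

/-- Products of the centred density ratios over distinct slots have mean zero. -/
theorem integral_prod_Y_sub_one [IsProbabilityMeasure PX] [IsMarkovKernel μ]
    [∀ k, IsMarkovKernel (μs k)] [IsMarkovKernel ρ] [IsMarkovKernel π]
    (hfac : IsFactored PX μ μs) (hcov : Covers PX μs π) {s : Finset (Fin K)} (hs : s.Nonempty)
    (hint : Integrable (fun t => ∏ k ∈ s, (Y μs π k t - 1)) (law PX μ ρ)) :
    ∫ t, ∏ k ∈ s, (Y μs π k t - 1) ∂(law PX μ ρ) = 0 := by
  classical
  let f (x : 𝒳) (k : Fin K) (j : Fin (d k)) : ℝ :=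
    slotMarginal π k x j / (μs k x).real {j} - 1
  have hint' : Integrable (fun u : 𝒳 × Slate d => ∏ k ∈ s, f u.1 k (u.2 k)) (PX ⊗ₘ μ) := by
    simpa [f, Y] using Integrable.integral_compProd
      (κ := Kernel.const Unit (PX ⊗ₘ μ)) (η := Kernel.prodMkLeft Unit ρ) (a := ()) hint
  have hreward : ∫ t, ∏ k ∈ s, (Y μs π k t - 1) ∂(law PX μ ρ) =
      ∫ u : 𝒳 × Slate d, ∏ k ∈ s, f u.1 k (u.2 k) ∂(PX ⊗ₘ μ) := by
    rw [law, Measure.integral_compProd hint]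
    simp [f, Y]
  rw [hreward, Measure.integral_compProd hint']
  refine integral_eq_zero_of_ae ?_
  filter_upwards [hfac, hcov] with x hx hcx
  -- Padding with 1 outside `s` gives a product over all slots, so the sum over slates becomes a
  -- product of slot sums; the one at any `k ∈ s` is zero.
  have hprod (a : Slate d) : (μ x).real {a} * ∏ k ∈ s, f x k (a k) =
      ∏ k, (μs k x).real {a k} * if k ∈ s then f x k (a k) else 1 := by
    rw [hx, Finset.prod_mul_distrib, Fintype.prod_ite_mem]
  obtain ⟨k, hk⟩ := hs
  rw [integral_fintype .of_finite]
  simp only [smul_eq_mul, hprod, Pi.zero_apply]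
  rw [← Fintype.prod_sum fun k j => (μs k x).real {j} * if k ∈ s then f x k j else 1]
  refine Finset.prod_eq_zero (Finset.mem_univ k) ?_
  simpa [hk, f] using sum_mul_ratio_sub_one (hcx k)

end SlateOPE

theorem lemma9 {𝒳 : Type*} [MeasurableSpace 𝒳] {K : ℕ} {d : Fin K → ℕ}
    -- context distribution, logging policy with its slot policies, reward model, target policy
    (PX : Measure 𝒳) [IsProbabilityMeasure PX]
    (μ : Kernel 𝒳 (SlateOPE.Slate d)) [IsMarkovKernel μ]
    (μs : (k : Fin K) → Kernel 𝒳 (Fin (d k))) [∀ k, IsMarkovKernel (μs k)]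
    (ρ : Kernel (𝒳 × SlateOPE.Slate d) ℝ) [IsMarkovKernel ρ]
    (π : Kernel 𝒳 (SlateOPE.Slate d)) [IsMarkovKernel π]
    (hfac : SlateOPE.IsFactored PX μ μs)
    (hcov : SlateOPE.Covers PX μs π)
    -- finite second moments
    (hGR : MemLp (SlateOPE.GR μs π) 2 (SlateOPE.law PX μ ρ))
    (hY : ∀ k, MemLp (SlateOPE.Y μs π k) 2 (SlateOPE.law PX μ ρ))
    -- iid data
    {Ω : Type*} [MeasurableSpace Ω] (Q : Measure Ω) [IsProbabilityMeasure Q]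
    (X : ℕ → Ω → 𝒳) (A : ℕ → Ω → SlateOPE.Slate d) (R : ℕ → Ω → ℝ)
    (hlaw : ∀ i, HasLaw (fun ω => ((X i ω, A i ω), R i ω)) (SlateOPE.law PX μ ρ) Q)
    (hind : iIndepFun (fun i ω => ((X i ω, A i ω), R i ω)) Q) :
    TendstoInDistribution
      (fun (n : ℕ) (ω : Ω) =>
        √(n : ℝ) *
          (SlateOPE.thetaHat μs π (fun i => ((X i ω, A i ω), R i ω)) n
              (SlateOPE.wHat μs π (fun i => ((X i ω, A i ω), R i ω)) n)
            - SlateOPE.theta (SlateOPE.law PX μ ρ) μs π))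
      atTop id (fun _ => Q)
      (gaussianReal 0 (SlateOPE.Vstar (SlateOPE.law PX μ ρ) μs π).toNNReal) := by
  have : IsProbabilityMeasure (SlateOPE.law PX μ ρ) := by
    unfold SlateOPE.law
    infer_instance
  have hY' (k : Fin K) : MemLp (fun t => SlateOPE.Y μs π k t - 1) 2 (SlateOPE.law PX μ ρ) :=
    (hY k).sub (memLp_const 1)
  have hmean (k : Fin K) : ∫ t, (SlateOPE.Y μs π k t - 1) ∂(SlateOPE.law PX μ ρ) = 0 := by
    have h := SlateOPE.integral_prod_Y_sub_one (ρ := ρ) hfac hcov (Finset.singleton_nonempty k)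
      (by simpa only [Finset.prod_singleton] using (hY' k).integrable (by norm_num))
    simpa only [Finset.prod_singleton] using h
  have horth (k l : Fin K) (hkl : k ≠ l) :
      ∫ t, (SlateOPE.Y μs π k t - 1) * (SlateOPE.Y μs π l t - 1) ∂(SlateOPE.law PX μ ρ) = 0 := by
    -- Two-slot products are integrable because each factor is square-integrable.
    have h := SlateOPE.integral_prod_Y_sub_one (ρ := ρ) hfac hcov (Finset.insert_nonempty k {l})
      (by simp only [Finset.prod_pair hkl]; exact (hY' k).integrable_mul (hY' l))
    simpa only [Finset.prod_pair hkl] using h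
  have h := tendstoInDistribution_sampleMean_sub_sampleRegressionCoeff hlaw hind hGR hY' hmean horth
  have hGam (w : Fin K → ℝ) : SlateOPE.Gam μs π w = fun t => SlateOPE.GR μs π t -
      ∑ k, w k * (SlateOPE.Y μs π k t - 1) := rfl
  simp only [SlateOPE.Vstar, SlateOPE.V, SlateOPE.thetaHat, SlateOPE.theta, SlateOPE.wHat,
    SlateOPE.empMean, hGam]
  simp only [sampleMean, sampleRegressionCoeff] at h
  exact h
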